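/- Let $K$ be the infinite king grid: the graph on $\mathbb{Z}\times\mathbb{Z}$ in which two distinct vertices are adjacent if and only if each of their two coordinates differs by at most $1$. Let $S$ be a set of vertices of a graph $G$. Each $s\in S$ carries a detector, whose correct value is $2$ if an intruder is at $s$, $1$ if an intruder is at a neighbor of $s$, and $0$ otherwise (in particular if there is no intruder); there is at most one intruder. The set $S$ is an error-correcting locating-dominating (ERR:LD) set of $G$ if, whenever at most one detector sends a wrong value (of any kind), the values sent by the detectors determine whether there is an intruder and, if so, at which vertex of $G$. For $S\subseteq\mathbb{Z}\times\mathbb{Z}$ let $Q_n=\{-n,\dots,n\}^2$. The lower and the upper density of $S$ are the $\liminf$ and the $\limsup$ of $|S\cap Q_n|/|Q_n|$ as $n\to\infty$, and $S$ has density $d$ if $|S\cap Q_n|/|Q_n|\to d$. Let $\mathrm{ERR{:}LD}(K)$ be the infimum of the upper densities of the ERR:LD sets of $K$. Then every ERR:LD set of $K$ has lower density at least $\frac{15}{38}$, and there is an ERR:LD set of $K$ that has density $\frac{7}{16}$. In particular, $$\frac{15}{38}\le \mathrm{ERR{:}LD}(K)\le\frac{7}{16}.$$ -/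

import Mathlib

open Filter Topology

/-- The infinite king grid: vertex set `ℤ × ℤ`, two distinct vertices being adjacent when a chess
king moves from one to the other in one step. -/
def kingGrid : SimpleGraph (ℤ × ℤ) where
  Adj p q := p ≠ q ∧ |p.1 - q.1| ≤ 1 ∧ |p.2 - q.2| ≤ 1
  symm := ⟨fun p q h => ⟨h.1.symm, abs_sub_comm p.1 q.1 ▸ h.2.1, abs_sub_comm p.2 q.2 ▸ h.2.2⟩⟩
  loopless := ⟨fun _ h => h.1 rfl⟩

open Classical in
/-- The values sent by the detectors in `S` when all of them work correctly. The state is `none`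
when there is no intruder and `some v` when there is an intruder at `v`. A detector sends `2` if the
intruder is at its own position, `1` if the intruder is in its open neighbourhood, `0` otherwise. -/
noncomputable def correctReadings {V : Type*} (G : SimpleGraph V) (S : Set V) :
    Option V → S → Fin 3
  | none, _ => 0
  | some v, s => if (s : V) = v then 2 else if G.Adj (s : V) v then 1 else 0

/-- `S` is an error-correcting locating-dominating (ERR:LD) set of `G`: from the values sent by the
detectors one can tell whether there is an intruder and where it is, even if at most one detector
sends a wrong value (of any kind). -/
def IsErrLD {V : Type*} (G : SimpleGraph V) (S : Set V) : Prop :=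
  ∃ locate : (S → Fin 3) → Option V, ∀ (state : Option V) (r : S → Fin 3),
    {s : S | r s ≠ correctReadings G S state s}.Subsingleton → locate r = state

/-- The square `[-n, n] × [-n, n]` of the grid. -/
noncomputable def gridBox (n : ℕ) : Finset (ℤ × ℤ) :=
  Finset.Icc (-(n : ℤ)) n ×ˢ Finset.Icc (-(n : ℤ)) n

/-- The proportion of the vertices of `gridBox n` that belong to `S`. -/
noncomputable def boxRatio (S : Set (ℤ × ℤ)) (n : ℕ) : ℝ :=
  ((S ∩ (gridBox n : Set (ℤ × ℤ))).ncard : ℝ) / ((gridBox n).card : ℝ)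

noncomputable def upperDensity (S : Set (ℤ × ℤ)) : ℝ := limsup (boxRatio S) atTop

noncomputable def lowerDensity (S : Set (ℤ × ℤ)) : ℝ := liminf (boxRatio S) atTop

def HasDensity (S : Set (ℤ × ℤ)) (d : ℝ) : Prop := Tendsto (boxRatio S) atTop (𝓝 d)

/-- `ERR:LD(G)`, the minimum (infimum) density of an ERR:LD set of a graph `G` on the grid points;
the density of a set is its upper density, which is its density whenever that exists. -/
noncomputable def minErrLDDensity (G : SimpleGraph (ℤ × ℤ)) : ℝ :=
  sInf {d : ℝ | ∃ S : Set (ℤ × ℤ), IsErrLD G S ∧ d = upperDensity S}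

/-! One wrong value can be corrected exactly when the correct readings of any two states differ at
three or more detectors (`isErrLD_iff_encard`). In the king grid this says that at least three
detectors satisfy `KingSep u v` for all `u`, `v`, the case `u = v` standing for comparison with the
absence of an intruder.

Lower bound: the cells of a 6 × 6 window get integer weights of sum 172. For `u`, `v` in the central
4 × 4 block all separating detectors lie in the window, so each condition is a linear inequality in
the 0-1 occupancies. `windowCert` is a branch-and-bound proof, with dual multipliers at its leaves,
that the occupied weight exceeds 67, hence is at least 68 by integrality. Averaging over all
translates gives lower density at least 68/172 = 17/43, slightly more than 15/38.

Upper bound: `periodicSet` has 7 points in each 4 × 4 block. Periodicity leaves finitely many close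
pairs to check, and for distant pairs the detectors near `u` suffice. -/

/-! ### Branch-and-bound certificates for the weighted window -/

/-- A branching proof that a weighted sum over the cells of a window is large. A cell of the window
is coded by `10 * row + column`. The node `branch c s t` distinguishes whether `c` is occupied (`s`)
or empty (`t`). A leaf holds a common scale of the weights and multipliers `(k, u, v)` for the
inequalities saying that three occupied cells separate `u` and `v`. -/
inductive Cert where
  | leaf (scale : ℕ) (mults : List (ℕ × ℕ × ℕ))
  | branch (c : ℕ) (occupied empty : Cert)

namespace Cert

def codeNear (c u : ℕ) : Bool :=
  Nat.ble (c / 10) (u / 10 + 1) && Nat.ble (u / 10) (c / 10 + 1) &&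
    Nat.ble (c % 10) (u % 10 + 1) && Nat.ble (u % 10) (c % 10 + 1)

/-- Whether a detector at `c` separates an intruder at `u` from one at `v`, or from the absence of
an intruder if `u = v`. -/
def codeSep (u v c : ℕ) : Bool :=
  bif Nat.beq u v then codeNear c u
  else Nat.beq c u || Nat.beq c v || (codeNear c u ^^ codeNear c v)

def cells : List ℕ :=
  [0, 1, 2, 3, 4, 5, 10, 11, 12, 13, 14, 15, 20, 21, 22, 23, 24, 25,
    30, 31, 32, 33, 34, 35, 40, 41, 42, 43, 44, 45, 50, 51, 52, 53, 54, 55]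

/-- The cells whose neighbourhoods lie in the window. -/
def innerCells : List ℕ := [11, 12, 13, 14, 21, 22, 23, 24, 31, 32, 33, 34, 41, 42, 43, 44]

/-- The weights are invariant under the symmetries of the square and vanish at the corners. -/
def weightTable : List (List ℕ) :=
  [[0, 2, 3, 3, 2, 0], [2, 6, 8, 8, 6, 2], [3, 8, 11, 11, 8, 3],
    [3, 8, 11, 11, 8, 3], [2, 6, 8, 8, 6, 2], [0, 2, 3, 3, 2, 0]]

def weight (c : ℕ) : ℕ := (weightTable.getD (c / 10) []).getD (c % 10) 0

def coeff (mults : List (ℕ × ℕ × ℕ)) (c : ℕ) : ℕ :=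
  (mults.map fun k => bif codeSep k.2.1 k.2.2 c then k.1 else 0).sum

def gain (scale : ℕ) (ones : List ℕ) (c : ℕ) : ℕ :=
  bif ones.contains c then scale * weight c else 0

/-- At an undecided cell the truncated subtraction is a positive part: it bounds `(coeff - scale *
weight) * x` for both values of `x`. -/
def loss (scale : ℕ) (mults : List (ℕ × ℕ × ℕ)) (ones zeros : List ℕ) (c : ℕ) : ℕ :=
  bif ones.contains c then coeff mults c
  else bif zeros.contains c then 0 else coeff mults c - scale * weight c

/-- Checks that the certificate shows the weight of the occupied cells to exceed `bound`, given that
the cells in `ones` are occupied and the cells in `zeros` are empty. -/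
def check (bound : ℕ) : Cert → List ℕ → List ℕ → Bool
  | leaf scale mults, ones, zeros =>
    mults.all (fun k => innerCells.contains k.2.1 && innerCells.contains k.2.2) &&
      Nat.blt (bound * scale + (cells.map (loss scale mults ones zeros)).sum)
        (3 * (mults.map Prod.fst).sum + (cells.map (gain scale ones)).sum)
  | branch c s t, ones, zeros => check bound s (c :: ones) zeros && check bound t ones (c :: zeros)

theorem three_mul_sum_le {x : ℕ → ℕ}
    (hsep : ∀ u ∈ innerCells, ∀ v ∈ innerCells,
      3 ≤ (cells.map fun c => bif codeSep u v c then x c else 0).sum)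
    (mults : List (ℕ × ℕ × ℕ)) (hm : ∀ k ∈ mults, k.2.1 ∈ innerCells ∧ k.2.2 ∈ innerCells) :
    3 * (mults.map Prod.fst).sum ≤ (cells.map fun c => coeff mults c * x c).sum := by
  induction mults with
  | nil => simp
  | cons k l ih =>
    have h1 := ih fun j hj => hm j (List.mem_cons_of_mem _ hj)
    obtain ⟨hu, hv⟩ := hm k List.mem_cons_self
    have h2 := Nat.mul_le_mul_left k.1 (hsep _ hu _ hv)
    have h3 : (cells.map fun c => coeff (k :: l) c * x c).sum =
        k.1 * (cells.map fun c => bif codeSep k.2.1 k.2.2 c then x c else 0).sum +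
          (cells.map fun c => coeff l c * x c).sum := by
      rw [← List.sum_map_mul_left, ← List.sum_map_add]
      congr 1
      refine List.map_congr_left fun c _ => ?_
      simp only [coeff, List.map_cons, List.sum_cons, add_mul]
      cases codeSep k.2.1 k.2.2 c <;> simp
    rw [h3, List.map_cons, List.sum_cons]
    lia

/-- Weak LP duality at a leaf: the combined inequalities bound `∑ coeff * x` below, and cell by cell
`coeff * x + gain ≤ scale * weight * x + loss`. Summing and dividing by `scale` gives the bound. A
branch splits on the value of `x c`. -/
theorem lt_of_check {x : ℕ → ℕ} (hx : ∀ c, x c ≤ 1)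
    (hsep : ∀ u ∈ innerCells, ∀ v ∈ innerCells,
      3 ≤ (cells.map fun c => bif codeSep u v c then x c else 0).sum)
    {bound : ℕ} (t : Cert) (ones zeros : List ℕ) (ht : t.check bound ones zeros)
    (h1 : ∀ c ∈ ones, x c = 1) (h0 : ∀ c ∈ zeros, x c = 0) :
    bound < (cells.map fun c => weight c * x c).sum := by
  induction t generalizing ones zeros with
  | leaf scale mults =>
    simp only [check, Bool.and_eq_true, List.all_eq_true, List.contains_iff_mem,
      Nat.blt_eq] at ht
    obtain ⟨hm, hlt⟩ := ht
    have hl := three_mul_sum_le hsep mults hm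
    have hcell : (cells.map fun c => coeff mults c * x c + gain scale ones c).sum ≤
        (cells.map fun c => scale * (weight c * x c) + loss scale mults ones zeros c).sum := by
      refine List.sum_le_sum fun c _ => ?_
      by_cases hc1 : c ∈ ones
      · simp [gain, loss, hc1, h1 c hc1, add_comm]
      by_cases hc0 : c ∈ zeros
      · simp [gain, loss, hc1, hc0, h0 c hc0]
      have := hx c
      interval_cases x c
      · simp [gain, loss, hc1, hc0]
      · simp [gain, loss, hc1, hc0]
        lia
    rw [List.sum_map_add, List.sum_map_add, List.sum_map_mul_left] at hcell
    refine lt_of_mul_lt_mul_left (a := scale) ?_ (Nat.zero_le _)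
    lia
  | branch c s t ihs iht =>
    simp only [check, Bool.and_eq_true] at ht
    have := hx c
    obtain h | h : x c = 0 ∨ x c = 1 := by lia
    · exact iht _ _ ht.2 h1 (by simpa [h] using h0)
    · exact ihs _ _ ht.1 (by simpa [h] using h1) h0

/-- The weight of the occupied cells of a window of an ERR:LD set is more than 67. -/
def windowCert : Cert :=
  .branch 33
   (.branch 32
    (.branch 15
     (.branch 10
      (.branch 44
       (.leaf 6 [(9, 12, 12), (9, 13, 13), (10, 31, 31), (8, 34, 34), (3, 12, 13), (11, 22, 23),
         (2, 31, 32), (3, 42, 43), (7, 23, 32), (4, 34, 43), (13, 22, 32), (5, 23, 33), (2, 31, 41),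
         (5, 32, 42), (5, 33, 43), (1, 23, 42)])
       (.branch 23
        (.leaf 4 [(5, 12, 12), (6, 13, 13), (8, 31, 31), (2, 12, 13), (7, 22, 23), (6, 42, 43),
          (3, 32, 34), (1, 12, 22), (5, 22, 32), (2, 23, 33), (5, 24, 34), (2, 31, 41), (5, 22, 33),
          (2, 23, 43)])
        (.leaf 2 [(4, 12, 12), (2, 13, 13), (4, 31, 31), (4, 34, 34), (5, 22, 23), (1, 32, 33),
          (1, 42, 43), (1, 33, 42), (3, 22, 32), (7, 23, 33), (2, 31, 41), (1, 33, 43),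
          (2, 34, 44)])))
      (.leaf 10 [(2, 11, 11), (1, 12, 12), (16, 13, 13), (13, 34, 34), (4, 12, 13), (28, 21, 22),
        (24, 22, 23), (2, 33, 34), (25, 42, 43), (11, 12, 22), (20, 21, 31), (15, 22, 32),
        (11, 23, 33), (5, 24, 34), (11, 33, 43), (6, 34, 44)]))
     (.leaf 16 [(28, 12, 12), (8, 13, 13), (2, 14, 14), (15, 31, 31), (3, 32, 32), (4, 12, 13),
       (17, 21, 22), (36, 22, 23), (46, 23, 24), (2, 31, 32), (50, 42, 43), (10, 13, 23),
       (15, 21, 31), (13, 22, 32), (14, 23, 33), (32, 24, 34), (10, 32, 42)]))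
    (.branch 22
     (.branch 11
      (.leaf 8 [(2, 13, 13), (2, 31, 31), (4, 43, 43), (4, 12, 13), (13, 23, 24), (10, 31, 32),
        (19, 32, 33), (5, 42, 43), (2, 43, 44), (12, 12, 21), (12, 23, 32), (7, 34, 43),
        (10, 13, 23), (4, 21, 31), (6, 22, 32), (11, 23, 33), (7, 24, 34), (11, 32, 42)])
      (.leaf 6 [(1, 21, 21), (1, 41, 41), (1, 43, 43), (8, 11, 12), (4, 12, 13), (19, 22, 23),
        (8, 23, 24), (8, 31, 32), (5, 32, 33), (3, 42, 43), (8, 43, 44), (8, 11, 21), (8, 13, 23),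
        (3, 21, 31), (24, 22, 32), (4, 24, 34), (8, 32, 42), (8, 34, 44)]))
     (.branch 24
      (.branch 15
       (.leaf 3 [(4, 31, 31), (3, 21, 22), (8, 22, 23), (2, 31, 32), (2, 33, 34), (1, 42, 43),
         (6, 12, 22), (3, 13, 23), (10, 22, 32), (1, 23, 33), (6, 32, 42), (7, 23, 34),
         (3, 32, 43)])
       (.leaf 2 [(3, 31, 31), (1, 43, 43), (2, 21, 22), (6, 22, 23), (6, 23, 24), (1, 31, 32),
         (1, 42, 43), (4, 12, 22), (2, 13, 23), (7, 22, 32), (5, 24, 34), (4, 32, 42), (1, 32, 43)]))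
      (.branch 11
       (.leaf 2 [(3, 13, 13), (4, 31, 31), (3, 33, 33), (1, 12, 13), (2, 21, 22), (3, 22, 23),
         (5, 23, 24), (3, 32, 33), (1, 33, 34), (1, 42, 43), (3, 12, 22), (4, 22, 32), (5, 24, 34),
         (3, 32, 42), (3, 33, 43)])
       (.leaf 1 [(1, 13, 13), (2, 21, 21), (1, 31, 31), (4, 22, 23), (2, 23, 24), (1, 43, 44),
         (1, 12, 22), (1, 13, 23), (5, 22, 32), (1, 24, 34), (1, 32, 42), (1, 33, 43), (1, 34, 44)])))))
   (.branch 23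
    (.branch 32
     (.branch 14
      (.leaf 8 [(2, 12, 12), (2, 34, 34), (4, 42, 42), (4, 12, 13), (13, 21, 22), (19, 32, 33),
        (10, 33, 34), (2, 41, 42), (5, 42, 43), (10, 12, 22), (7, 21, 31), (11, 22, 32),
        (6, 23, 33), (4, 24, 34), (11, 33, 43), (12, 13, 24), (12, 22, 33), (7, 31, 42)])
      (.leaf 6 [(1, 24, 24), (1, 42, 42), (1, 44, 44), (4, 12, 13), (8, 13, 14), (8, 21, 22),
        (19, 22, 23), (5, 32, 33), (8, 33, 34), (8, 41, 42), (3, 42, 43), (8, 12, 22), (8, 14, 24),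
        (4, 21, 31), (24, 23, 33), (3, 24, 34), (8, 31, 41), (8, 33, 43)]))
     (.branch 12
      (.branch 1
       (.leaf 3 [(4, 43, 43), (3, 21, 22), (1, 22, 23), (6, 31, 32), (10, 32, 33), (6, 33, 34),
         (7, 13, 22), (3, 24, 33), (2, 13, 23), (8, 22, 32), (1, 24, 34), (3, 32, 42), (2, 33, 43)])
       (.leaf 2 [(1, 24, 24), (3, 43, 43), (5, 12, 13), (2, 21, 22), (4, 31, 32), (7, 32, 33),
         (4, 33, 34), (1, 24, 33), (6, 12, 22), (5, 22, 32), (1, 24, 34), (2, 32, 42), (1, 33, 43)]))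
      (.branch 13
       (.leaf 4 [(5, 21, 21), (3, 33, 33), (1, 42, 42), (8, 43, 43), (8, 12, 13), (6, 23, 24),
         (6, 31, 32), (13, 32, 33), (6, 33, 34), (12, 12, 22), (2, 21, 31), (8, 22, 32),
         (2, 24, 34), (3, 32, 42), (1, 21, 32)])
       (.leaf 4 [(2, 22, 22), (3, 23, 23), (3, 24, 24), (4, 42, 42), (8, 43, 43), (12, 12, 13),
         (8, 21, 22), (3, 23, 24), (4, 31, 32), (10, 32, 33), (6, 33, 34), (12, 12, 22),
         (10, 22, 32), (4, 23, 33), (2, 24, 34)]))))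
    (.branch 21
     (.branch 31
      (.branch 22
       (.leaf 8 [(9, 23, 23), (8, 24, 24), (3, 34, 34), (12, 43, 43), (4, 11, 12), (8, 23, 24),
         (11, 31, 32), (7, 32, 33), (5, 33, 34), (16, 13, 23), (5, 21, 31), (27, 23, 33),
         (8, 32, 42), (4, 33, 43), (4, 12, 23), (7, 21, 32)])
       (.leaf 4 [(7, 23, 23), (7, 33, 33), (8, 21, 22), (4, 22, 23), (4, 23, 24), (4, 31, 32),
         (8, 33, 34), (2, 33, 42), (8, 12, 22), (4, 13, 23), (13, 23, 33), (2, 32, 42),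
         (8, 33, 43)]))
      (.branch 32
       (.branch 10
        (.leaf 5 [(4, 24, 24), (9, 34, 34), (2, 42, 42), (1, 21, 22), (13, 22, 23), (1, 23, 24),
          (1, 31, 32), (1, 33, 34), (3, 42, 43), (12, 22, 31), (5, 33, 42), (10, 12, 22),
          (5, 13, 23), (4, 22, 32), (13, 23, 33), (8, 33, 43)])
        (.leaf 3 [(3, 24, 24), (6, 34, 34), (1, 42, 42), (9, 21, 22), (8, 22, 23), (2, 42, 43),
          (2, 33, 42), (6, 12, 22), (3, 13, 23), (8, 21, 31), (2, 22, 32), (8, 23, 33),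
          (5, 33, 43)]))
       (.leaf 6 [(16, 22, 22), (2, 24, 24), (5, 32, 32), (12, 42, 42), (3, 12, 13), (1, 21, 22),
         (14, 22, 23), (4, 23, 24), (17, 31, 32), (19, 32, 33), (12, 33, 34), (9, 12, 22),
         (9, 13, 23), (17, 23, 33), (6, 33, 43)])))
     (.branch 32
      (.branch 14
       (.leaf 2 [(3, 12, 12), (3, 32, 32), (4, 34, 34), (1, 12, 13), (5, 21, 22), (3, 22, 23),
         (2, 23, 24), (1, 31, 32), (3, 32, 33), (1, 42, 43), (3, 13, 23), (5, 21, 31), (4, 23, 33),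
         (3, 32, 42), (3, 33, 43)])
       (.leaf 1 [(1, 12, 12), (2, 24, 24), (1, 34, 34), (2, 21, 22), (4, 22, 23), (1, 41, 42),
         (1, 12, 22), (1, 13, 23), (1, 21, 31), (5, 23, 33), (1, 31, 41), (1, 32, 42), (1, 33, 43)]))
      (.branch 12
       (.leaf 6 [(7, 12, 12), (4, 24, 24), (16, 32, 32), (3, 34, 34), (3, 12, 13), (10, 21, 22),
         (4, 22, 23), (5, 23, 24), (8, 31, 32), (18, 32, 33), (5, 33, 34), (9, 13, 23), (2, 21, 31),
         (12, 23, 33), (3, 24, 34), (12, 32, 42), (6, 33, 43), (2, 12, 23)])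
       (.leaf 2 [(5, 22, 22), (2, 23, 23), (3, 32, 32), (1, 12, 13), (1, 21, 22), (4, 23, 24),
         (3, 31, 32), (6, 32, 33), (2, 33, 34), (3, 13, 23), (1, 21, 31), (6, 23, 33), (4, 32, 42),
         (2, 33, 43), (3, 12, 23), (2, 21, 32)])))))

theorem check_windowCert : windowCert.check 67 [] [] := by decide +kernel

end Cert

/-! ### Error correction as threefold separation -/

/-- The usual criterion of coding theory: one error can be corrected if and only if distinct
codewords have Hamming distance at least 3. -/
theorem isErrLD_iff_encard {V : Type*} {G : SimpleGraph V} {S : Set V} :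
    IsErrLD G S ↔ ∀ a b : Option V, a ≠ b →
      3 ≤ {s : S | correctReadings G S a s ≠ correctReadings G S b s}.encard := by
  classical
  constructor
  · rintro ⟨locate, hloc⟩ a b hab
    by_contra! hlt
    have hle : {s : S | correctReadings G S a s ≠ correctReadings G S b s}.encard ≤ 2 :=
      Order.le_of_lt_add_one (by rw [two_add_one_eq_three]; exact hlt)
    have hfin := Set.finite_of_encard_le_coe hle
    have hsplit : ∃ s : Set S, s.Subsingleton ∧
        ({s : S | correctReadings G S a s ≠ correctReadings G S b s} \ s).Subsingleton := by
      rcases Set.eq_empty_or_nonempty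
        {s : S | correctReadings G S a s ≠ correctReadings G S b s} with h | ⟨s, hs⟩
      · exact ⟨∅, Set.subsingleton_empty, by simp [h]⟩
      · refine ⟨{s}, Set.subsingleton_singleton, ?_⟩
        rw [← Set.encard_le_one_iff_subsingleton]
        have := Set.encard_sdiff_singleton_add_one hs
        rw [← this, ← one_add_one_eq_two] at hle
        exact (ENat.add_le_add_iff_right (by simp)).1 hle
    obtain ⟨s, hs, hs'⟩ := hsplit
    -- With at most two differences, split as `s` and the rest, this hybrid word is within one error
    -- of both states.
    let r : S → Fin 3 := fun t => if t ∈ s then correctReadings G S b t else correctReadings G S a t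
    have ha : locate r = a := hloc a r <| hs.anti fun t ht => by
      by_contra hts
      exact ht (by simp [r, hts])
    have hb : locate r = b := hloc b r <| hs'.anti fun t ht => by
      by_cases hts : t ∈ s
      · exact absurd (by simp [r, hts]) ht
      · exact ⟨by simpa [r, hts] using ht, hts⟩
    exact hab (ha.symm.trans hb)
  · intro h
    -- Decode to any state within one error; the triangle inequality makes it unique. The value
    -- `none` in the other case is immaterial.
    refine ⟨fun r => if hr : ∃ a, {s : S | r s ≠ correctReadings G S a s}.Subsingleton
      then hr.choose else none, fun b r hb => ?_⟩
    have hr : ∃ a, {s : S | r s ≠ correctReadings G S a s}.Subsingleton := ⟨b, hb⟩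
    simp only [dif_pos hr]
    by_contra hne
    have h3 := h _ _ hne
    have hsub : {s : S | correctReadings G S hr.choose s ≠ correctReadings G S b s} ⊆
        {s : S | r s ≠ correctReadings G S hr.choose s} ∪
          {s : S | r s ≠ correctReadings G S b s} := by
      intro s hs
      by_contra hn
      simp only [Set.mem_union, Set.mem_ofPred_eq, not_or, not_not] at hn
      exact hs (hn.1.symm.trans hn.2)
    have := calc (3 : ℕ∞) ≤ _ := h3
      _ ≤ _ := Set.encard_le_encard hsub
      _ ≤ _ := Set.encard_union_le _ _
      _ ≤ 1 + 1 := add_le_add (Set.encard_le_one_iff_subsingleton.2 hr.choose_spec)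
        (Set.encard_le_one_iff_subsingleton.2 hb)
    exact absurd this (by norm_num)

def KingNear (p q : ℤ × ℤ) : Prop := |p.1 - q.1| ≤ 1 ∧ |p.2 - q.2| ≤ 1

instance : DecidableRel KingNear := fun p q =>
  inferInstanceAs (Decidable (|p.1 - q.1| ≤ 1 ∧ |p.2 - q.2| ≤ 1))

theorem KingNear.rfl {p : ℤ × ℤ} : KingNear p p := by simp [KingNear]

/-- Whether the correct value of a detector at `s` distinguishes an intruder at `u` from one at `v`,
or from the absence of an intruder if `u = v`. -/
abbrev KingSep (u v s : ℤ × ℤ) : Prop :=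
  if u = v then KingNear s u else s = u ∨ s = v ∨ (KingNear s u ↔ ¬ KingNear s v)

theorem KingSep.near_or_near {u v s : ℤ × ℤ} (h : KingSep u v s) : KingNear s u ∨ KingNear s v := by
  unfold KingSep at h
  split_ifs at h with huv
  · exact Or.inl h
  · rcases h with rfl | rfl | h
    · exact Or.inl KingNear.rfl
    · exact Or.inr KingNear.rfl
    · by_cases hv : KingNear s v
      · exact Or.inr hv
      · exact Or.inl (h.2 hv)

theorem correctReadings_kingGrid_some (S : Set (ℤ × ℤ)) (v : ℤ × ℤ) (s : S) :
    correctReadings kingGrid S (some v) s =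
      if (s : ℤ × ℤ) = v then 2 else if KingNear s v then 1 else 0 := by
  unfold correctReadings kingGrid
  by_cases h : (s : ℤ × ℤ) = v
  · simp [h]
  · simp only [h, if_false, ne_eq, not_false_eq_true, true_and, KingNear]
    congr

theorem correctReadings_ne_none_iff (S : Set (ℤ × ℤ)) (v : ℤ × ℤ) (s : S) :
    correctReadings kingGrid S (some v) s ≠ correctReadings kingGrid S none s ↔
      KingSep v v s := by
  rw [correctReadings_kingGrid_some, correctReadings, KingSep, if_pos rfl]
  by_cases h : (s : ℤ × ℤ) = v
  · simp [h, KingNear.rfl]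
  · by_cases h' : KingNear s v <;> simp [h, h']

theorem correctReadings_ne_some_iff (S : Set (ℤ × ℤ)) {u v : ℤ × ℤ} (huv : u ≠ v) (s : S) :
    correctReadings kingGrid S (some u) s ≠ correctReadings kingGrid S (some v) s ↔
      KingSep u v s := by
  rw [correctReadings_kingGrid_some, correctReadings_kingGrid_some, KingSep, if_neg huv]
  by_cases hu : (s : ℤ × ℤ) = u
  · by_cases h : KingNear u v <;> simp [hu, huv, h]
  by_cases hv : (s : ℤ × ℤ) = v
  · by_cases h : KingNear v u <;> simp [hv, huv.symm, h]
  by_cases h : KingNear s u <;> by_cases h' : KingNear s v <;> simp [hu, hv, h, h']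

theorem isErrLD_kingGrid_iff {S : Set (ℤ × ℤ)} :
    IsErrLD kingGrid S ↔ ∀ u v, 3 ≤ {s | s ∈ S ∧ KingSep u v s}.encard := by
  have himage : ∀ P : ℤ × ℤ → Prop, {s | s ∈ S ∧ P s}.encard = {s : S | P s}.encard := fun P => by
    rw [← Subtype.val_injective.encard_image]
    congr 1
    ext s
    exact ⟨fun h => ⟨⟨s, h.1⟩, h.2, rfl⟩, fun ⟨t, ht, hts⟩ => hts ▸ ⟨t.2, ht⟩⟩
  simp only [himage, isErrLD_iff_encard]
  constructor
  · intro h u v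
    by_cases huv : u = v
    · subst huv
      simpa only [correctReadings_ne_none_iff] using h (some u) none (by simp)
    · simpa only [correctReadings_ne_some_iff S huv] using h (some u) (some v) (by simpa using huv)
  · rintro h (_ | u) (_ | v) huv
    · exact absurd rfl huv
    · simpa only [ne_comm (a := correctReadings kingGrid S none _), correctReadings_ne_none_iff]
        using h v v
    · simpa only [correctReadings_ne_none_iff] using h u u
    · simpa only [correctReadings_ne_some_iff S (fun e => huv (congrArg some e))] using h u v

/-! ### Averaging over boxes and densities -/

theorem mem_gridBox {n : ℕ} {p : ℤ × ℤ} : p ∈ gridBox n ↔ |p.1| ≤ n ∧ |p.2| ≤ n := by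
  simp [gridBox, abs_le]

theorem card_gridBox (n : ℕ) : (gridBox n).card = (2 * n + 1) ^ 2 := by
  rw [gridBox, Finset.card_product, Int.card_Icc, sq]
  congr <;> lia

theorem card_filter_translate_le (S : Set (ℤ × ℤ)) [DecidablePred (· ∈ S)] {d : ℤ × ℤ}
    {k : ℕ} (h1 : |d.1| ≤ k) (h2 : |d.2| ≤ k) (m : ℕ) :
    ((gridBox m).filter fun p => p + d ∈ S).card ≤
      (S ∩ (gridBox (m + k) : Set (ℤ × ℤ))).ncard := by
  rw [← Set.ncard_coe_finset]
  refine Set.ncard_le_ncard_of_injOn (· + d) (fun p hp => ?_) (add_left_injective d).injOn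
    ((Finset.finite_toSet _).inter_of_right _)
  simp only [Finset.coe_filter, Set.mem_ofPred_eq, mem_gridBox] at hp
  refine ⟨hp.2, Finset.mem_coe.2 (mem_gridBox.2 ?_)⟩
  push_cast
  exact ⟨(abs_add_le _ _).trans (add_le_add hp.1.1 h1),
    (abs_add_le _ _).trans (add_le_add hp.1.2 h2)⟩

theorem le_card_filter_translate (S : Set (ℤ × ℤ)) [DecidablePred (· ∈ S)] {d : ℤ × ℤ}
    {k : ℕ} (h1 : |d.1| ≤ k) (h2 : |d.2| ≤ k) (m : ℕ) :
    (S ∩ (gridBox m : Set (ℤ × ℤ))).ncard ≤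
      ((gridBox (m + k)).filter fun p => p + d ∈ S).card := by
  rw [← Set.ncard_coe_finset]
  refine Set.ncard_le_ncard_of_injOn (· - d) (fun p hp => ?_) (sub_left_injective (b := d)).injOn
    (Finset.finite_toSet _)
  have hp' := mem_gridBox.1 (Finset.mem_coe.1 hp.2)
  simp only [Finset.coe_filter, Set.mem_ofPred_eq, mem_gridBox, sub_add_cancel]
  push_cast
  exact ⟨⟨(abs_sub _ _).trans (add_le_add hp'.1 h1), (abs_sub _ _).trans (add_le_add hp'.2 h2)⟩,
    hp.1⟩

section Averaging

variable {ι : Type*} {S : Set (ℤ × ℤ)} [DecidablePred (· ∈ S)] {I : Finset ι}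
  {o : ι → ℤ × ℤ} {w : ι → ℕ} {k b : ℕ}

theorem sum_gridBox_sum (m : ℕ) :
    ∑ p ∈ gridBox m, ∑ i ∈ I, w i * (if p + o i ∈ S then 1 else 0) =
      ∑ i ∈ I, w i * ((gridBox m).filter fun p => p + o i ∈ S).card := by
  rw [Finset.sum_comm]
  refine Finset.sum_congr rfl fun i _ => ?_
  rw [← Finset.mul_sum, Finset.card_filter]

/-- If every translate of a weighted pattern meets `S` in weight at least `b`, then `S` has
proportion at least `b / ∑ w` in large boxes. -/
theorem mul_card_gridBox_le (ho : ∀ i ∈ I, |(o i).1| ≤ k ∧ |(o i).2| ≤ k)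
    (h : ∀ p, b ≤ ∑ i ∈ I, w i * (if p + o i ∈ S then 1 else 0)) (m : ℕ) :
    b * (2 * m + 1) ^ 2 ≤ (∑ i ∈ I, w i) * (S ∩ (gridBox (m + k) : Set (ℤ × ℤ))).ncard := by
  calc b * (2 * m + 1) ^ 2
      = ∑ p ∈ gridBox m, b := by rw [Finset.sum_const, card_gridBox, smul_eq_mul, mul_comm]
    _ ≤ ∑ p ∈ gridBox m, ∑ i ∈ I, w i * (if p + o i ∈ S then 1 else 0) :=
      Finset.sum_le_sum fun p _ => h p
    _ ≤ _ := by
      rw [sum_gridBox_sum, Finset.sum_mul]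
      exact Finset.sum_le_sum fun i hi =>
        Nat.mul_le_mul_left _ (card_filter_translate_le S (ho i hi).1 (ho i hi).2 m)

/-- If every translate of a weighted pattern meets `S` in weight at most `b`, then `S` has
proportion at most `b / ∑ w` in large boxes. -/
theorem mul_ncard_inter_gridBox_le (ho : ∀ i ∈ I, |(o i).1| ≤ k ∧ |(o i).2| ≤ k)
    (h : ∀ p, ∑ i ∈ I, w i * (if p + o i ∈ S then 1 else 0) ≤ b) (m : ℕ) :
    (∑ i ∈ I, w i) * (S ∩ (gridBox m : Set (ℤ × ℤ))).ncard ≤ b * (2 * (m + k) + 1) ^ 2 := by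
  calc _ ≤ ∑ p ∈ gridBox (m + k), ∑ i ∈ I, w i * (if p + o i ∈ S then 1 else 0) := by
        rw [sum_gridBox_sum, Finset.sum_mul]
        exact Finset.sum_le_sum fun i hi =>
          Nat.mul_le_mul_left _ (le_card_filter_translate S (ho i hi).1 (ho i hi).2 m)
    _ ≤ ∑ p ∈ gridBox (m + k), b := Finset.sum_le_sum fun p _ => h p
    _ = _ := by rw [Finset.sum_const, card_gridBox, smul_eq_mul, mul_comm]

end Averaging

theorem boxRatio_eq (S : Set (ℤ × ℤ)) (n : ℕ) :
    boxRatio S n = ((S ∩ (gridBox n : Set (ℤ × ℤ))).ncard : ℝ) / (2 * n + 1) ^ 2 := by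
  rw [boxRatio, card_gridBox]
  push_cast
  rfl

theorem boxRatio_nonneg (S : Set (ℤ × ℤ)) (n : ℕ) : 0 ≤ boxRatio S n := by
  unfold boxRatio
  positivity

theorem boxRatio_le_one (S : Set (ℤ × ℤ)) (n : ℕ) : boxRatio S n ≤ 1 := by
  refine div_le_one_of_le₀ (Nat.cast_le.2 ?_) (Nat.cast_nonneg _)
  rw [← Set.ncard_coe_finset]
  exact Set.ncard_le_ncard Set.inter_subset_right (Finset.finite_toSet _)

theorem lowerDensity_le_upperDensity (S : Set (ℤ × ℤ)) : lowerDensity S ≤ upperDensity S :=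
  liminf_le_limsup (isBoundedUnder_of ⟨1, boxRatio_le_one S⟩)
    (isBoundedUnder_of ⟨0, boxRatio_nonneg S⟩)

/-- Enlarging or shrinking a box by a bounded margin does not affect limiting proportions. -/
theorem tendsto_shifted_square_ratio (a c : ℝ) :
    Tendsto (fun n : ℕ => c * (2 * n + a) ^ 2 / (2 * n + 1) ^ 2) atTop (𝓝 c) := by
  have h : Tendsto (fun n : ℕ => c * (1 + (a - 1) / (2 * (n : ℝ) + 1)) ^ 2) atTop
      (𝓝 (c * (1 + 0) ^ 2)) := by
    refine ((tendsto_const_nhds.add (tendsto_const_nhds.div_atTop ?_)).pow 2).const_mul c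
    exact tendsto_atTop_add_const_right _ _
      (tendsto_natCast_atTop_atTop.const_mul_atTop two_pos)
  simp only [add_zero, one_pow, mul_one] at h
  refine h.congr fun n => ?_
  have : (2 * (n : ℝ) + 1) ≠ 0 := by positivity
  field_simp
  ring

/-! ### The lower bound -/

namespace Cert

def codePos (c : ℕ) : ℤ × ℤ := ((c / 10 : ℕ), (c % 10 : ℕ))

theorem codeNear_iff (p : ℤ × ℤ) (c u : ℕ) :
    codeNear c u = true ↔ KingNear (p + codePos c) (p + codePos u) := by
  simp only [codeNear, KingNear, codePos, Bool.and_eq_true, Nat.ble_eq, Prod.fst_add, Prod.snd_add,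
    abs_le]
  lia

theorem codePos_injective : Function.Injective codePos := fun c u h => by
  simp only [codePos, Prod.mk.injEq] at h
  lia

theorem codeSep_iff (p : ℤ × ℤ) (u v c : ℕ) :
    codeSep u v c = true ↔ KingSep (p + codePos u) (p + codePos v) (p + codePos c) := by
  have hu := codeNear_iff p c u
  have hv := codeNear_iff p c v
  by_cases huv : u = v
  · simp [codeSep, huv, KingSep, hv]
  · have : Nat.beq u v = false :=
      Bool.eq_false_iff.2 fun h => huv (Nat.eq_of_beq_eq_true h)
    simp only [codeSep, this, cond_false, KingSep, add_right_inj, codePos_injective.eq_iff, huv,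
      if_false, ← hu, ← hv, Bool.or_eq_true, Nat.beq_eq, or_assoc]
    cases codeNear c u <;> cases codeNear c v <;> simp

theorem exists_cell_of_near {p s : ℤ × ℤ} {u : ℕ} (hu : u ∈ innerCells)
    (h : KingNear s (p + codePos u)) : ∃ c ∈ cells, s = p + codePos c := by
  have hcells : ∀ i < 6, ∀ j < 6, 10 * i + j ∈ cells := by decide
  have hinner : ∀ u ∈ innerCells, 1 ≤ u / 10 ∧ u / 10 ≤ 4 ∧ 1 ≤ u % 10 ∧ u % 10 ≤ 4 := by decide
  have hu' := hinner u hu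
  simp only [KingNear, codePos, Prod.fst_add, Prod.snd_add, abs_le] at h
  refine ⟨10 * (s.1 - p.1).toNat + (s.2 - p.2).toNat, hcells _ (by lia) _ (by lia), ?_⟩
  ext <;> simp only [codePos, Prod.fst_add, Prod.snd_add] <;> lia

open Classical in
theorem lt_weight_of_isErrLD {S : Set (ℤ × ℤ)} (hS : IsErrLD kingGrid S) (p : ℤ × ℤ) :
    67 < ∑ c ∈ cells.toFinset, weight c * (if p + codePos c ∈ S then 1 else 0) := by
  have hnd : cells.Nodup := by decide
  rw [List.sum_toFinset _ hnd]
  refine lt_of_check (x := fun c => if p + codePos c ∈ S then 1 else 0)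
    (fun c => by split_ifs <;> simp) (fun u hu v hv => ?_) windowCert [] []
    check_windowCert (by simp) (by simp)
  rw [← List.sum_toFinset _ hnd]
  have hsum : ∑ c ∈ cells.toFinset,
        (bif codeSep u v c then (if p + codePos c ∈ S then 1 else 0) else 0) =
      (cells.toFinset.filter fun c => codeSep u v c = true ∧ p + codePos c ∈ S).card := by
    rw [Finset.card_filter]
    refine Finset.sum_congr rfl fun c _ => ?_
    cases codeSep u v c <;> simp
  rw [hsum, ← Nat.cast_le (α := ℕ∞), ← Set.encard_coe_eq_coe_finsetCard]
  -- All separating detectors are near one of two inner cells, so none is lost by restricting to the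
  -- window.
  refine (isErrLD_kingGrid_iff.1 hS (p + codePos u) (p + codePos v)).trans ?_
  refine (Set.encard_le_encard ?_).trans (Set.encard_image_le (fun c => p + codePos c) _)
  intro s hs
  obtain ⟨hsS, hsep⟩ := hs
  obtain ⟨c, hc, rfl⟩ : ∃ c ∈ cells, s = p + codePos c :=
    hsep.near_or_near.elim (exists_cell_of_near hu) (exists_cell_of_near hv)
  exact ⟨c, by simp [hc, hsS, (codeSep_iff p u v c).2 hsep], rfl⟩

theorem sum_weight : ∑ c ∈ cells.toFinset, weight c = 172 := by decide +kernel

theorem abs_codePos_le {c : ℕ} (hc : c ∈ cells.toFinset) :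
    |(codePos c).1| ≤ (5 : ℕ) ∧ |(codePos c).2| ≤ (5 : ℕ) := by
  revert c
  decide +kernel

end Cert

open Classical in
/-- The window weights sum to 172, and each window of an ERR:LD set has weight at least 68. -/
theorem IsErrLD.le_lowerDensity {S : Set (ℤ × ℤ)} (hS : IsErrLD kingGrid S) :
    68 / 172 ≤ lowerDensity S := by
  -- With `n = m + 5`, the side `2 * m + 1` is `2 * n - 9`.
  have hlim := tendsto_shifted_square_ratio (-9) (68 / 172)
  rw [← hlim.liminf_eq]
  refine liminf_le_liminf ?_ hlim.isBoundedUnder_ge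
    (isBoundedUnder_of ⟨1, boxRatio_le_one S⟩).isCoboundedUnder_ge
  filter_upwards [eventually_ge_atTop 5] with n hn
  obtain ⟨m, rfl⟩ := Nat.exists_eq_add_of_le' hn
  have h := mul_card_gridBox_le (S := S) (b := 68) (fun c hc => Cert.abs_codePos_le hc)
    (Cert.lt_weight_of_isErrLD hS) m
  rw [Cert.sum_weight] at h
  rw [boxRatio_eq]
  gcongr
  have h' : (68 : ℝ) * (2 * m + 1) ^ 2 ≤ 172 * (S ∩ (gridBox (m + 5) : Set (ℤ × ℤ))).ncard := by
    exact_mod_cast h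
  push_cast
  linarith

/-! ### The periodic set of density 7/16 -/

/-- A set of period 4 in both directions with 7 elements in each period. -/
def periodicSet : Set (ℤ × ℤ) :=
  {p | p.1 % 4 + 4 * (p.2 % 4) ∈ ([0, 1, 2, 5, 8, 10, 15] : List ℤ)}

instance : DecidablePred (· ∈ periodicSet) := fun p =>
  inferInstanceAs (Decidable (p.1 % 4 + 4 * (p.2 % 4) ∈ ([0, 1, 2, 5, 8, 10, 15] : List ℤ)))

theorem add_mem_periodicSet_iff (p d : ℤ × ℤ) :
    p + d ∈ periodicSet ↔ (p.1 % 4, p.2 % 4) + d ∈ periodicSet := by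
  simp only [periodicSet, Set.mem_ofPred_eq, Prod.fst_add, Prod.snd_add, Int.emod_add_emod]

theorem emod_four_mem_Icc (p : ℤ × ℤ) :
    (p.1 % 4, p.2 % 4) ∈ Finset.Icc (0 : ℤ) 3 ×ˢ Finset.Icc (0 : ℤ) 3 := by
  simp only [Finset.mem_product, Finset.mem_Icc]
  lia

theorem card_periodicSet_block (p : ℤ × ℤ) :
    ∑ d ∈ Finset.Icc (0 : ℤ) 3 ×ˢ Finset.Icc (0 : ℤ) 3,
      1 * (if p + d ∈ periodicSet then 1 else 0) = 7 := by
  have h : ∀ r ∈ Finset.Icc (0 : ℤ) 3 ×ˢ Finset.Icc (0 : ℤ) 3,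
      ∑ d ∈ Finset.Icc (0 : ℤ) 3 ×ˢ Finset.Icc (0 : ℤ) 3,
        1 * (if r + d ∈ periodicSet then 1 else 0) = 7 := by decide +kernel
  simpa only [add_mem_periodicSet_iff p] using h _ (emod_four_mem_Icc p)

theorem kingNear_add_left (u p q : ℤ × ℤ) : KingNear (u + p) (u + q) ↔ KingNear p q := by
  simp [KingNear]

theorem kingSep_add_left (u p q s : ℤ × ℤ) : KingSep (u + p) (u + q) (u + s) ↔ KingSep p q s := by
  simp [KingSep, kingNear_add_left]

/-- With `u` reduced modulo 4 to `r` and moved to the origin, the neighbourhoods of `0` and `d` both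
lie in `[-3, 3]²`, so the count there is complete. -/
theorem three_le_card_sep_periodicSet :
    ∀ r ∈ Finset.Icc (0 : ℤ) 3 ×ˢ Finset.Icc (0 : ℤ) 3,
      ∀ d ∈ Finset.Icc (-2 : ℤ) 2 ×ˢ Finset.Icc (-2 : ℤ) 2,
        3 ≤ ((Finset.Icc (-3 : ℤ) 3 ×ˢ Finset.Icc (-3 : ℤ) 3).filter fun e =>
          r + e ∈ periodicSet ∧ KingSep 0 d e).card := by
  decide +kernel

theorem three_le_encard_sep_of_close {u d : ℤ × ℤ} (h1 : |d.1| ≤ 2) (h2 : |d.2| ≤ 2) :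
    3 ≤ {s | s ∈ periodicSet ∧ KingSep u (u + d) s}.encard := by
  have h := three_le_card_sep_periodicSet _ (emod_four_mem_Icc u) d (by
    simpa only [Finset.mem_product, Finset.mem_Icc, ← abs_le] using ⟨h1, h2⟩)
  rw [← Nat.cast_le (α := ℕ∞), ← Set.encard_coe_eq_coe_finsetCard,
    ← (add_right_injective u).encard_image] at h
  refine h.trans (Set.encard_le_encard ?_)
  rintro _ ⟨e, he, rfl⟩
  simp only [Finset.coe_filter, Set.mem_ofPred_eq] at he
  refine ⟨(add_mem_periodicSet_iff u e).2 he.2.1, ?_⟩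
  simpa using (kingSep_add_left u 0 d e).2 he.2.2

theorem isErrLD_periodicSet : IsErrLD kingGrid periodicSet := by
  rw [isErrLD_kingGrid_iff]
  intro u v
  by_cases h : |(v - u).1| ≤ 2 ∧ |(v - u).2| ≤ 2
  · simpa using three_le_encard_sep_of_close (u := u) h.1 h.2
  -- The closed neighbourhoods of `u` and `v` are now disjoint, so the three detectors near `u` (the
  -- case `d = 0`) separate the two.
  · refine (three_le_encard_sep_of_close (u := u) (d := 0) (by simp) (by simp)).trans
      (Set.encard_le_encard fun s hs => ⟨hs.1, ?_⟩)
    have hu : KingNear s u := by simpa [KingSep] using hs.2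
    have hv : ¬ KingNear s v := by
      simp only [KingNear, Prod.fst_sub, Prod.snd_sub, abs_le] at h hu ⊢
      lia
    have huv : u ≠ v := by
      rintro rfl
      exact hv hu
    simp [KingSep, huv, hu, hv]

theorem hasDensity_periodicSet : HasDensity periodicSet (7 / 16) := by
  have ho : ∀ d ∈ Finset.Icc (0 : ℤ) 3 ×ˢ Finset.Icc (0 : ℤ) 3,
      |d.1| ≤ (3 : ℕ) ∧ |d.2| ≤ (3 : ℕ) := by decide +kernel
  have hcard : ∑ d ∈ Finset.Icc (0 : ℤ) 3 ×ˢ Finset.Icc (0 : ℤ) 3, 1 = 16 := by simp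
  -- The shifts come from `2 * (n - 3) + 1 = 2 * n - 5` and `2 * (n + 3) + 1 = 2 * n + 7`.
  refine tendsto_of_tendsto_of_tendsto_of_le_of_le' (tendsto_shifted_square_ratio (-5) (7 / 16))
    (tendsto_shifted_square_ratio 7 (7 / 16)) ?_ (Eventually.of_forall fun n => ?_)
  · filter_upwards [eventually_ge_atTop 3] with n hn
    obtain ⟨m, rfl⟩ := Nat.exists_eq_add_of_le' hn
    have h := mul_card_gridBox_le (S := periodicSet) (b := 7) (w := fun _ => 1) (o := fun d => d) ho
      (fun p => (card_periodicSet_block p).ge) m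
    rw [hcard] at h
    rw [boxRatio_eq]
    gcongr
    have h' : (7 : ℝ) * (2 * m + 1) ^ 2 ≤
        16 * (periodicSet ∩ (gridBox (m + 3) : Set (ℤ × ℤ))).ncard := by
      exact_mod_cast h
    push_cast
    linarith
  · have h := mul_ncard_inter_gridBox_le (S := periodicSet) (b := 7) (w := fun _ => 1) (o := fun d => d) ho
      (fun p => (card_periodicSet_block p).le) n
    rw [hcard] at h
    rw [boxRatio_eq]
    gcongr
    have h' : (16 : ℝ) * (periodicSet ∩ (gridBox n : Set (ℤ × ℤ))).ncard ≤
        7 * (2 * (n + 3) + 1) ^ 2 := by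
      exact_mod_cast h
    linarith

theorem mainTheorem1 :
    (∀ S : Set (ℤ × ℤ), IsErrLD kingGrid S → 15 / 38 ≤ lowerDensity S) ∧
    (∃ S : Set (ℤ × ℤ), IsErrLD kingGrid S ∧ HasDensity S (7 / 16)) ∧
    15 / 38 ≤ minErrLDDensity kingGrid ∧ minErrLDDensity kingGrid ≤ 7 / 16 := by
  have hlower : ∀ S : Set (ℤ × ℤ), IsErrLD kingGrid S → 15 / 38 ≤ lowerDensity S := fun S hS =>
    le_trans (by norm_num) hS.le_lowerDensity
  have hmem : (7 / 16 : ℝ) ∈ {d : ℝ | ∃ S : Set (ℤ × ℤ), IsErrLD kingGrid S ∧ d = upperDensity S} :=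
    ⟨periodicSet, isErrLD_periodicSet, hasDensity_periodicSet.limsup_eq.symm⟩
  have hbound : ∀ d ∈ {d : ℝ | ∃ S : Set (ℤ × ℤ), IsErrLD kingGrid S ∧ d = upperDensity S},
      15 / 38 ≤ d := by
    rintro _ ⟨S, hS, rfl⟩
    exact (hlower S hS).trans (lowerDensity_le_upperDensity S)
  exact ⟨hlower, ⟨periodicSet, isErrLD_periodicSet, hasDensity_periodicSet⟩,
    le_csInf ⟨_, hmem⟩ hbound, csInf_le ⟨_, hbound⟩ hmem⟩
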